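/- A function $f:\mathbb{R}^m\to\mathbb{R}$ is called DC if it is the difference of two convex functions on $\mathbb{R}^m$. For $d\ge 1$ let $\mathcal{D}_d$ be the system consisting of $\varnothing$ and of all nonempty closed sets $A\subset\mathbb{R}^d$ whose Euclidean distance function $d_A=\operatorname{dist}(\cdot,A)$ is DC on $\mathbb{R}^d$. Let $d\ge 2$ and let $g:\mathbb{R}^{d-1}\to\mathbb{R}$ be locally Lipschitz. If $\operatorname{graph} g=\{(y,g(y)):y\in\mathbb{R}^{d-1}\}\subset\mathbb{R}^d$ belongs to $\mathcal{D}_d$, then $g$ is DC. -/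

import Mathlib

/-- A real function on the real vector space `E` is DC if it is the difference of two convex
functions on `E`. -/
def IsDC {E : Type*} [AddCommGroup E] [Module ℝ E] (f : E → ℝ) : Prop :=
  ∃ f₁ f₂ : E → ℝ, ConvexOn ℝ Set.univ f₁ ∧ ConvexOn ℝ Set.univ f₂ ∧ ∀ x, f x = f₁ x - f₂ x

/-- The system `𝒟_d` of closed subsets of Euclidean `ℝ^d` with DC distance function (the empty set
is included by convention). -/
def DCDistSets (d : ℕ) : Set (Set (EuclideanSpace ℝ (Fin d))) :=
  {∅} ∪ {A | A.Nonempty ∧ IsClosed A ∧ IsDC (fun x => Metric.infDist x A)}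

/-- The graph `{(y, g y) : y ∈ ℝ^n}` of `g : ℝ^n → ℝ`, as a subset of Euclidean `ℝ^(n+1)`: the
points whose last coordinate is `g` of the vector of the first `n` coordinates. -/
def euclideanGraph {n : ℕ} (g : EuclideanSpace ℝ (Fin n) → ℝ) :
    Set (EuclideanSpace ℝ (Fin (n + 1))) :=
  {x | x (Fin.last n) = g (WithLp.toLp 2 fun i : Fin n => x i.castSucc)}

open Filter Topology

/-! Write the distance to the graph, in coordinates `(y, t)`, as `P - Q` with `P`, `Q` convex. It
vanishes on the graph and, `g` being locally Lipschitz, is at least `c * |t - g y|` on bounded sets.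
If `s` is a subgradient of `Q (y, ·)` at `g y` and `|s - A| ≤ c`, then `t ↦ P (y, t) - A * t` is
minimal at `g y`. Its minimum over `t` is convex in `y`, and subtracting the minima for two slopes
at distance `c` around `s` leaves `c * g y`. Only finitely many slopes `i * c` are needed on a ball,
so there `g` is a continuous selection of finitely many DC functions (`isDC_of_convex_gap`). Such a
selection has second differences dominated by those of a convex function
(`exists_convex_control_of_selection`), and these local controls are glued over annuli
(`isDC_of_locally_controlled`). -/

/-! ### Second differences -/

/-- The symmetric second difference of `f` at `x` in direction `v`. -/
def secondDiff {E : Type*} [AddCommGroup E] (f : E → ℝ) (x v : E) : ℝ :=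
  f (x + v) + f (x - v) - 2 * f x

theorem secondDiff_finset_sum {E ι : Type*} [AddCommGroup E] (s : Finset ι) (f : ι → E → ℝ) (x v : E) :
    secondDiff (fun y => ∑ i ∈ s, f i y) x v = ∑ i ∈ s, secondDiff (f i) x v := by
  simp only [secondDiff, Finset.sum_sub_distrib, Finset.sum_add_distrib, Finset.mul_sum]

section SecondDiff

variable {E : Type*} [AddCommGroup E] [Module ℝ E]

theorem ConvexOn.secondDiff_nonneg {f : E → ℝ} (hf : ConvexOn ℝ Set.univ f) (x v : E) :
    0 ≤ secondDiff f x v := by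
  have h := hf.2 (Set.mem_univ (x + v)) (Set.mem_univ (x - v))
    (show (0 : ℝ) ≤ 1 / 2 by norm_num) (show (0 : ℝ) ≤ 1 / 2 by norm_num) (by norm_num)
  have e : (1 / 2 : ℝ) • (x + v) + (1 / 2 : ℝ) • (x - v) = x := by module
  rw [e] at h
  simp only [smul_eq_mul] at h
  unfold secondDiff
  linarith

theorem convexOn_univ_finset_sum {ι : Type*} (s : Finset ι) (f : ι → E → ℝ)
    (hf : ∀ i ∈ s, ConvexOn ℝ Set.univ (f i)) :
    ConvexOn ℝ Set.univ (fun y => ∑ i ∈ s, f i y) := by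
  classical
  induction s using Finset.induction_on with
  | empty => simpa using convexOn_const (0 : ℝ) convex_univ
  | insert a s ha ih =>
    simp only [Finset.sum_insert ha]
    exact (hf a (Finset.mem_insert_self a s)).add
      (ih fun i hi => hf i (Finset.mem_insert_of_mem hi))

end SecondDiff

/-! ### From local control of second differences to DC functions -/

section Local

variable {E : Type*} [NormedAddCommGroup E] [NormedSpace ℝ E]

theorem ConvexOn.continuous_of_univ [FiniteDimensional ℝ E] {f : E → ℝ}
    (hf : ConvexOn ℝ Set.univ f) : Continuous f :=
  hf.locallyLipschitz.continuous

/-- A continuous function that is locally midpoint convex is convex. -/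
theorem convexOn_univ_of_eventually_secondDiff_nonneg {u : E → ℝ} (hu : Continuous u)
    (h : ∀ x, ∀ᶠ v in 𝓝 (0 : E), 0 ≤ secondDiff u x v) : ConvexOn ℝ Set.univ u := by
  refine ⟨convex_univ, fun x _ y _ a b ha hb hab => ?_⟩
  set w : ℝ → ℝ := fun t => u (x + t • (y - x)) - ((1 - t) * u x + t * u y) with hw
  have hwc : Continuous w := by fun_prop
  suffices H : ∀ t ∈ Set.Icc (0 : ℝ) 1, w t ≤ 0 by
    have hb' := H b ⟨hb, by linarith⟩
    have ea : a = 1 - b := by linarith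
    have e : a • x + b • y = x + b • (y - x) := by rw [ea]; module
    rw [e, ea]
    simp only [hw] at hb'
    simp only [smul_eq_mul]
    linarith
  by_contra! hcon
  obtain ⟨t1, ht1, hpos⟩ := hcon
  obtain ⟨t2, ht2, hmax⟩ := isCompact_Icc.exists_isMaxOn ⟨t1, ht1⟩ hwc.continuousOn
  have hK : IsCompact (Set.Icc (0 : ℝ) 1 ∩ w ⁻¹' {w t2}) :=
    isCompact_Icc.inter_right (isClosed_singleton.preimage hwc)
  -- At the leftmost maximum point the value just to the left is strictly smaller, so the second
  -- difference there is negative.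
  obtain ⟨t0, ⟨ht0, hwt0⟩, hleast⟩ := hK.exists_isLeast ⟨t2, ht2, rfl⟩
  have hwt0 : w t0 = w t2 := hwt0
  have hM : 0 < w t0 := by rw [hwt0]; exact hpos.trans_le (hmax ht1)
  have h0 : w 0 = 0 := by simp [hw]
  have h1 : w 1 = 0 := by simp [hw]
  have ht0' : 0 < t0 := lt_of_le_of_ne ht0.1 (by rintro rfl; linarith)
  have ht0'' : t0 < 1 := lt_of_le_of_ne ht0.2 (by rintro rfl; linarith)
  have hcont : Tendsto (fun δ : ℝ => δ • (y - x)) (𝓝 0) (𝓝 0) := by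
    have : Continuous fun δ : ℝ => δ • (y - x) := by fun_prop
    simpa using this.tendsto 0
  have hev := hcont.eventually (h (x + t0 • (y - x)))
  have hev' : ∀ᶠ δ : ℝ in 𝓝[>] 0, 0 ≤ secondDiff u (x + t0 • (y - x)) (δ • (y - x)) ∧
      δ < t0 ∧ δ < 1 - t0 ∧ 0 < δ := by
    filter_upwards [nhdsWithin_le_nhds hev, nhdsWithin_le_nhds (Iio_mem_nhds ht0'),
      nhdsWithin_le_nhds (Iio_mem_nhds (sub_pos.2 ht0'')), self_mem_nhdsWithin]
      with δ a b c d using ⟨a, b, c, d⟩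
  obtain ⟨δ, hδ, hδ1, hδ2, hδ0⟩ := hev'.exists
  have ha1 : w (t0 + δ) ≤ w t2 := hmax (show t0 + δ ∈ Set.Icc (0 : ℝ) 1 by
    constructor <;> linarith)
  have hmem : t0 - δ ∈ Set.Icc (0 : ℝ) 1 := by constructor <;> linarith
  have ha2 : w (t0 - δ) < w t2 := by
    refine lt_of_le_of_ne (hmax hmem) fun he => ?_
    have : t0 ≤ t0 - δ := hleast ⟨hmem, he⟩
    linarith
  have e1 : x + t0 • (y - x) + δ • (y - x) = x + (t0 + δ) • (y - x) := by module
  have e2 : x + t0 • (y - x) - δ • (y - x) = x + (t0 - δ) • (y - x) := by module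
  simp only [secondDiff, e1, e2] at hδ
  simp only [hw] at ha1 ha2 hwt0
  nlinarith

/-- A function whose second differences are controlled, locally around every point of every ball,
by those of a convex function is DC. -/
theorem isDC_of_locally_controlled [FiniteDimensional ℝ E] {g : E → ℝ} (hg : Continuous g)
    (H : ∀ R : ℝ, ∃ ψ : E → ℝ, ConvexOn ℝ Set.univ ψ ∧
      ∀ x ∈ Metric.ball (0 : E) R, ∀ᶠ v in 𝓝 (0 : E), |secondDiff g x v| ≤ secondDiff ψ x v) :
    IsDC g := by
  have H' : ∀ k : ℕ, ∃ e : E → ℝ, ConvexOn ℝ Set.univ e ∧ (∀ x, ‖x‖ + 1 ≤ k → e x = 0) ∧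
      ∀ x, (k : ℝ) ≤ ‖x‖ → ‖x‖ < k + 1 →
        ∀ᶠ v in 𝓝 (0 : E), |secondDiff g x v| ≤ secondDiff e x v := by
    intro k
    obtain ⟨ψ, hψ, hctl⟩ := H (k + 1)
    obtain ⟨M, hM⟩ := (isCompact_closedBall (0 : E) (k + 1)).exists_bound_of_continuousOn
      hψ.continuous_of_univ.continuousOn
    have hM0 : 0 ≤ M := (norm_nonneg _).trans (hM 0 (by simp; positivity))
    have hℓ : ConvexOn ℝ Set.univ
        (fun x : E => ψ x + (2 * (M + 1)) • ‖x‖ + -(2 * (M + 1) * (k - 1 / 2))) :=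
      (hψ.add (convexOn_univ_norm.smul (by positivity))).add_const _
    -- With `|ψ| ≤ M` on the ball of radius `k + 1`, the added cone makes the second argument
    -- negative for `‖x‖ ≤ k - 1` and positive for `k ≤ ‖x‖ ≤ k + 1`.
    refine ⟨fun x => max 0 (ψ x + (2 * (M + 1)) • ‖x‖ + -(2 * (M + 1) * (k - 1 / 2))),
      (convexOn_const 0 convex_univ).sup hℓ, fun x hx => ?_, fun x hx1 hx2 => ?_⟩
    · have := hM x (by simp; linarith)
      rw [Real.norm_eq_abs, abs_le] at this
      refine max_eq_left ?_
      simp only [smul_eq_mul]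
      nlinarith
    · have hb := hM x (by simp; linarith)
      rw [Real.norm_eq_abs, abs_le] at hb
      have hpos : 0 < ψ x + (2 * (M + 1)) • ‖x‖ + -(2 * (M + 1) * (k - 1 / 2)) := by
        simp only [smul_eq_mul]
        nlinarith
      have hc := hℓ.continuous_of_univ
      have c1 : ∀ᶠ v in 𝓝 (0 : E),
          0 < ψ (x + v) + (2 * (M + 1)) • ‖x + v‖ + -(2 * (M + 1) * (k - 1 / 2)) := by
        have : Continuous fun v : E => x + v := by fun_prop
        exact ((hc.comp this).tendsto 0).eventually_const_lt (by simpa using hpos)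
      have c2 : ∀ᶠ v in 𝓝 (0 : E),
          0 < ψ (x - v) + (2 * (M + 1)) • ‖x - v‖ + -(2 * (M + 1) * (k - 1 / 2)) := by
        have : Continuous fun v : E => x - v := by fun_prop
        exact ((hc.comp this).tendsto 0).eventually_const_lt (by simpa using hpos)
      filter_upwards [hctl x (by simpa using hx2), c1, c2] with v h1 h2 h3
      refine h1.trans ?_
      have hn := (convexOn_univ_norm (E := E)).secondDiff_nonneg x v
      simp only [secondDiff] at hn ⊢
      rw [max_eq_right h2.le, max_eq_right h3.le, max_eq_right hpos.le]
      simp only [smul_eq_mul]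
      nlinarith
  choose e he hzero hectl using H'
  -- The sum of all `e k`: the omitted terms vanish at `x`.
  set h : E → ℝ := fun x => ∑ k ∈ Finset.range (⌈‖x‖⌉₊ + 1), e k x with hh
  have hsum : ∀ (N : ℕ) (x : E), ‖x‖ + 1 ≤ N → h x = ∑ k ∈ Finset.range N, e k x := by
    intro N x hN
    have hle : ⌈‖x‖⌉₊ + 1 ≤ N := by
      have : ⌈‖x‖ + 1⌉₊ ≤ N := Nat.ceil_le.2 hN
      rwa [Nat.ceil_add_one (norm_nonneg x)] at this
    refine Finset.sum_subset (Finset.range_mono hle) fun k _ hk => hzero k x ?_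
    have hk' : ⌈‖x‖⌉₊ + 1 ≤ k := by simpa using hk
    have : ((⌈‖x‖⌉₊ + 1 : ℕ) : ℝ) ≤ k := by exact_mod_cast hk'
    push_cast at this
    linarith [Nat.le_ceil ‖x‖]
  have hpart : ∀ N : ℕ, ConvexOn ℝ Set.univ fun x => ∑ k ∈ Finset.range N, e k x :=
    fun N => convexOn_univ_finset_sum _ _ fun k _ => he k
  have hconv : ConvexOn ℝ Set.univ h := by
    refine ⟨convex_univ, fun x _ y _ a b ha hb hab => ?_⟩
    obtain ⟨N, hN⟩ := exists_nat_ge (max ‖x‖ ‖y‖ + 1)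
    have hx : ‖x‖ + 1 ≤ N := by linarith [le_max_left ‖x‖ ‖y‖]
    have hy : ‖y‖ + 1 ≤ N := by linarith [le_max_right ‖x‖ ‖y‖]
    have hxy : ‖a • x + b • y‖ + 1 ≤ N := by
      have := (convexOn_univ_norm (E := E)).2 (Set.mem_univ x) (Set.mem_univ y) ha hb hab
      simp only [smul_eq_mul] at this
      nlinarith
    rw [hsum N x hx, hsum N y hy, hsum N _ hxy]
    exact (hpart N).2 (Set.mem_univ x) (Set.mem_univ y) ha hb hab
  have hctl : ∀ x, ∀ᶠ v in 𝓝 (0 : E), |secondDiff g x v| ≤ secondDiff h x v := by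
    intro x
    set k := ⌊‖x‖⌋₊ with hk
    have hk1 : (k : ℝ) ≤ ‖x‖ := Nat.floor_le (norm_nonneg x)
    have hk2 : ‖x‖ < k + 1 := Nat.lt_floor_add_one _
    have hsmall : ∀ᶠ v in 𝓝 (0 : E), ‖v‖ < 1 := by
      filter_upwards [Metric.ball_mem_nhds (0 : E) one_pos] with v hv using by simpa using hv
    filter_upwards [hectl k x hk1 hk2, hsmall] with v hv hv1
    have b0 : ‖x‖ + 1 ≤ (k + 3 : ℕ) := by push_cast; linarith
    have b1 : ‖x + v‖ + 1 ≤ (k + 3 : ℕ) := by push_cast; linarith [norm_add_le x v]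
    have b2 : ‖x - v‖ + 1 ≤ (k + 3 : ℕ) := by push_cast; linarith [norm_sub_le x v]
    have hD : secondDiff h x v = ∑ j ∈ Finset.range (k + 3), secondDiff (e j) x v := by
      rw [← secondDiff_finset_sum, secondDiff, hsum _ _ b0, hsum _ _ b1, hsum _ _ b2, secondDiff]
    rw [hD]
    exact hv.trans (Finset.single_le_sum (f := fun j => secondDiff (e j) x v)
      (fun j _ => (he j).secondDiff_nonneg x v) (Finset.mem_range.2 (by omega)))
  have hp : ConvexOn ℝ Set.univ fun x => h x + g x := by
    refine convexOn_univ_of_eventually_secondDiff_nonneg (hconv.continuous_of_univ.add hg)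
      fun x => ?_
    filter_upwards [hctl x] with v hv
    have := (abs_le.1 hv).1
    simp only [secondDiff] at this ⊢
    linarith
  have hm : ConvexOn ℝ Set.univ fun x => h x - g x := by
    refine convexOn_univ_of_eventually_secondDiff_nonneg (hconv.continuous_of_univ.sub hg)
      fun x => ?_
    filter_upwards [hctl x] with v hv
    have := (abs_le.1 hv).2
    simp only [secondDiff] at this ⊢
    linarith
  refine ⟨_, _, hp.smul (c := 1 / 2) (by norm_num), hm.smul (c := 1 / 2) (by norm_num),
    fun x => ?_⟩
  simp only [smul_eq_mul]
  ring

/-- The local form of the mixing lemma: a continuous function that coincides, at every point of an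
open set, with one of finitely many DC functions is controlled on this set by a convex function. -/
theorem exists_convex_control_of_selection [FiniteDimensional ℝ E] {ι : Type*} (s : Finset ι)
    (f : ι → E → ℝ) (hf : ∀ i ∈ s, IsDC (f i)) {g : E → ℝ} (hg : Continuous g) {U : Set E}
    (hU : IsOpen U) (hsel : ∀ x ∈ U, ∃ i ∈ s, g x = f i x) :
    ∃ ψ : E → ℝ, ConvexOn ℝ Set.univ ψ ∧
      ∀ x ∈ U, ∀ᶠ v in 𝓝 (0 : E), |secondDiff g x v| ≤ secondDiff ψ x v := by
  classical
  choose! p q hp hq hpq using hf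
  have hfc : ∀ i ∈ s, Continuous (f i) := fun i hi => by
    rw [funext (hpq i hi)]
    exact (hp i hi).continuous_of_univ.sub (hq i hi).continuous_of_univ
  set φ : E → ℝ := fun x => ∑ i ∈ s, (p i x + q i x) with hφ
  have hφi : ∀ i ∈ s, ConvexOn ℝ Set.univ fun x => p i x + q i x :=
    fun i hi => (hp i hi).add (hq i hi)
  have hφc : ConvexOn ℝ Set.univ φ := convexOn_univ_finset_sum _ _ hφi
  have hctl : ∀ i ∈ s, ∀ x v, |secondDiff (f i) x v| ≤ secondDiff φ x v := by
    intro i hi x v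
    have h1 := (hp i hi).secondDiff_nonneg x v
    have h2 := (hq i hi).secondDiff_nonneg x v
    have h3 : secondDiff (fun y => p i y + q i y) x v ≤ secondDiff φ x v := by
      rw [hφ, secondDiff_finset_sum]
      exact Finset.single_le_sum (f := fun j => secondDiff (fun y => p j y + q j y) x v)
        (fun j hj => (hφi j hj).secondDiff_nonneg x v) hi
    refine le_trans ?_ h3
    simp only [secondDiff, hpq i hi] at h1 h2 ⊢
    rw [abs_le]
    constructor <;> linarith
  -- Adding `2 * φ` makes both `f i - f j` and its negative convex; the absolute value is their
  -- maximum.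
  have hpair : ∀ i ∈ s, ∀ j ∈ s, ConvexOn ℝ Set.univ fun x => |f i x - f j x| + 2 * φ x := by
    intro i hi j hj
    have hadd : ∀ i ∈ s, ∀ j ∈ s, ConvexOn ℝ Set.univ fun x => (f i x - f j x) + 2 * φ x := by
      intro i hi j hj
      refine convexOn_univ_of_eventually_secondDiff_nonneg
        (((hfc i hi).sub (hfc j hj)).add (hφc.continuous_of_univ.const_mul 2))
        fun x => Eventually.of_forall fun v => ?_
      have h1 := (abs_le.1 (hctl i hi x v)).1
      have h2 := (abs_le.1 (hctl j hj x v)).2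
      simp only [secondDiff] at h1 h2 ⊢
      linarith
    refine ((hadd i hi j hj).sup (hadd j hj i hi)).congr fun x _ => ?_
    simp only [Pi.sup_apply, abs_eq_max_neg, neg_sub]
    exact max_add_add_right _ _ _
  set S : E → ℝ := fun x => ∑ a ∈ s ×ˢ s, (|f a.1 x - f a.2 x| + 2 * φ x) with hS
  have hpair' : ∀ a ∈ s ×ˢ s, ConvexOn ℝ Set.univ fun x => |f a.1 x - f a.2 x| + 2 * φ x :=
    fun a ha => hpair _ (Finset.mem_product.1 ha).1 _ (Finset.mem_product.1 ha).2
  have hSc : ConvexOn ℝ Set.univ S := convexOn_univ_finset_sum _ _ hpair'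
  refine ⟨fun x => φ x + S x, hφc.add hSc, fun x hx => ?_⟩
  obtain ⟨i, hi, hgi⟩ := hsel x hx
  set I := s.filter fun j => f j x = g x with hI
  -- Near `x` only the `f j` active at `x` can be selected, so `r` bounds `|g - f i|`; as `r x = 0`,
  -- the second difference of `g` differs from that of `f i` by at most that of `r`.
  set r : E → ℝ := fun y => ∑ j ∈ I, |f i y - f j y| with hr
  have hrx : r x = 0 := Finset.sum_eq_zero fun j hj => by
    rw [(Finset.mem_filter.1 hj).2, ← hgi, sub_self, abs_zero]
  have hrS : ∀ v, secondDiff r x v ≤ secondDiff S x v := by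
    intro v
    have h1 : secondDiff r x v ≤
        ∑ j ∈ I, secondDiff (fun y => |f i y - f j y| + 2 * φ y) x v := by
      rw [hr, secondDiff_finset_sum]
      refine Finset.sum_le_sum fun j _ => ?_
      have := hφc.secondDiff_nonneg x v
      simp only [secondDiff] at this ⊢
      linarith
    refine h1.trans ?_
    rw [hS, secondDiff_finset_sum, Finset.sum_product]
    have h2 : ∀ a ∈ s, 0 ≤ ∑ j ∈ s, secondDiff (fun y => |f a y - f j y| + 2 * φ y) x v :=
      fun a ha => Finset.sum_nonneg fun j hj => (hpair a ha j hj).secondDiff_nonneg x v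
    refine le_trans ?_ (Finset.single_le_sum h2 hi)
    exact Finset.sum_le_sum_of_subset_of_nonneg (Finset.filter_subset _ _)
      fun j hj _ => (hpair i hi j hj).secondDiff_nonneg x v
  have hnear : ∀ᶠ y in 𝓝 x, |g y - f i y| ≤ r y := by
    have hne : ∀ᶠ y in 𝓝 x, ∀ j ∈ s, f j x ≠ g x → f j y ≠ g y := by
      rw [Finset.eventually_all]
      intro j hj
      by_cases hjx : f j x = g x
      · exact Eventually.of_forall fun y h => absurd hjx h
      · filter_upwards [(isOpen_ne_fun (hfc j hj) hg).mem_nhds hjx]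
          with y hy _ using hy
    filter_upwards [hne, hU.mem_nhds hx] with y hy hyU
    obtain ⟨j, hj, hgj⟩ := hsel y hyU
    have hjI : j ∈ I := Finset.mem_filter.2 ⟨hj, by
      by_contra hcon
      exact hy j hj hcon hgj.symm⟩
    rw [hgj, abs_sub_comm]
    exact Finset.single_le_sum (f := fun j => |f i y - f j y|) (fun _ _ => abs_nonneg _) hjI
  have t1 : Tendsto (fun v : E => x + v) (𝓝 0) (𝓝 x) := by
    have : Continuous fun v : E => x + v := by fun_prop
    simpa using this.tendsto 0
  have t2 : Tendsto (fun v : E => x - v) (𝓝 0) (𝓝 x) := by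
    have : Continuous fun v : E => x - v := by fun_prop
    simpa using this.tendsto 0
  filter_upwards [t1.eventually hnear, t2.eventually hnear] with v h1 h2
  have h3 := abs_le.1 (hctl i hi x v)
  have h4 := hrS v
  rw [abs_le] at h1 h2 ⊢
  simp only [secondDiff, hrx] at h3 h4 ⊢
  constructor <;> linarith [h1.1, h1.2, h2.1, h2.2, h3.1, h3.2]

end Local

theorem ConvexOn.exists_subgradient_real {q : ℝ → ℝ} (hq : ConvexOn ℝ Set.univ q) (t₀ : ℝ) :
    ∃ s : ℝ, ∀ t, q t₀ + s * (t - t₀) ≤ q t := by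
  have hint : ∀ t : ℝ, t ∈ interior Set.univ := by simp
  refine ⟨derivWithin q (Set.Ioi t₀) t₀, fun t => ?_⟩
  rcases lt_trichotomy t t₀ with h | rfl | h
  · have h1 := hq.slope_le_leftDeriv_of_mem_interior (Set.mem_univ t) (hint t₀) h
    have h2 := h1.trans (hq.leftDeriv_le_rightDeriv_of_mem_interior (hint t₀))
    rw [slope_def_field, div_le_iff₀ (by linarith)] at h2
    linarith
  · simp
  · have h1 := hq.rightDeriv_le_slope_of_mem_interior (hint t₀) (Set.mem_univ t) h
    rw [slope_def_field, le_div_iff₀ (by linarith)] at h1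
    linarith

/-! ### Recovering `g` from tilted partial minima -/

section PartialMin

variable {E : Type*} [NormedAddCommGroup E]

/-- The minimum over `t ∈ [-T, T]` of the tilted function `P (y, t) - A * t`. -/
noncomputable def partialMin (P : E × ℝ → ℝ) (T A : ℝ) (y : E) : ℝ :=
  sInf ((fun t => P (y, t) - A * t) '' Set.Icc (-T) T)

theorem isLeast_partialMin {P : E × ℝ → ℝ} (hP : Continuous P) {T : ℝ} (hT : 0 ≤ T) (A : ℝ)
    (y : E) : IsLeast ((fun t => P (y, t) - A * t) '' Set.Icc (-T) T) (partialMin P T A y) := by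
  have hne : (Set.Icc (-T) T).Nonempty := ⟨0, by constructor <;> linarith⟩
  refine IsCompact.isLeast_sInf (isCompact_Icc.image (by fun_prop)) (hne.image _)

variable [NormedSpace ℝ E]

/-- By joint convexity, the convex combination of two minimisers is a competitor at the intermediate
point. -/
theorem convexOn_partialMin {P : E × ℝ → ℝ} (hPc : Continuous P) (hP : ConvexOn ℝ Set.univ P)
    {T : ℝ} (hT : 0 ≤ T) (A : ℝ) : ConvexOn ℝ Set.univ (partialMin P T A) := by
  refine ⟨convex_univ, fun x _ y _ a b ha hb hab => ?_⟩
  obtain ⟨t, ht, hxt⟩ := (isLeast_partialMin hPc hT A x).1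
  obtain ⟨r, hr, hyr⟩ := (isLeast_partialMin hPc hT A y).1
  have h1 := (isLeast_partialMin hPc hT A (a • x + b • y)).2
    ⟨a • t + b • r, convex_Icc _ _ ht hr ha hb hab, rfl⟩
  have h2 := hP.2 (Set.mem_univ (x, t)) (Set.mem_univ (y, r)) ha hb hab
  refine h1.trans ?_
  rw [← hxt, ← hyr]
  simp only [Prod.smul_mk, Prod.mk_add_mk, smul_eq_mul] at h2 ⊢
  linarith

/-- If a difference `P - Q` of convex functions of `(y, t)` vanishes on the graph of `g` and, on
bounded sets, grows at least linearly in `|t - g y|`, then `g` is DC. -/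
theorem isDC_of_convex_gap [FiniteDimensional ℝ E] {g : E → ℝ} (hg : Continuous g)
    {P Q : E × ℝ → ℝ} (hP : ConvexOn ℝ Set.univ P) (hQ : ConvexOn ℝ Set.univ Q)
    (hPQ : ∀ y, P (y, g y) = Q (y, g y))
    (hgap : ∀ R T : ℝ, ∃ c > 0, ∀ y t, ‖y‖ ≤ R → |t| ≤ T →
      Q (y, t) + c * |t - g y| ≤ P (y, t)) : IsDC g := by
  have hPc := hP.continuous_of_univ
  have hQc := hQ.continuous_of_univ
  refine isDC_of_locally_controlled hg fun R => ?_
  have hK : IsCompact (Metric.closedBall (0 : E) R) := isCompact_closedBall 0 R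
  obtain ⟨T₀, hT₀⟩ := hK.exists_bound_of_continuousOn hg.continuousOn
  obtain ⟨K₁, hK₁⟩ := hK.exists_bound_of_continuousOn
    (f := fun y => Q (y, g y + 1) - Q (y, g y)) (by fun_prop)
  obtain ⟨K₂, hK₂⟩ := hK.exists_bound_of_continuousOn
    (f := fun y => Q (y, g y - 1) - Q (y, g y)) (by fun_prop)
  set T := max T₀ 0
  have hT : 0 ≤ T := le_max_right _ _
  obtain ⟨c, hc, hcgap⟩ := hgap R T
  obtain ⟨N, hN⟩ := exists_nat_ge (max K₁ K₂ / c + 1)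
  refine exists_convex_control_of_selection (Finset.Icc (-(N : ℤ)) N)
    (fun i y => (partialMin P T (i * c) y - partialMin P T ((i + 1) * c) y) / c)
    (fun i _ => ?_) hg Metric.isOpen_ball fun y hy => ?_
  · refine ⟨_, _, (convexOn_partialMin hPc hP hT (i * c)).smul (c := 1 / c) (by positivity),
      (convexOn_partialMin hPc hP hT ((i + 1) * c)).smul (c := 1 / c) (by positivity),
      fun x => ?_⟩
    simp only [smul_eq_mul]
    ring
  have hy' : y ∈ Metric.closedBall (0 : E) R := Metric.ball_subset_closedBall hy
  have hyR : ‖y‖ ≤ R := by simpa using hy'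
  have hgT : |g y| ≤ T := (hT₀ y hy').trans (le_max_left _ _)
  have hQy : ConvexOn ℝ Set.univ fun t : ℝ => Q (y, t) := by
    refine ⟨convex_univ, fun t _ r _ a b ha hb hab => ?_⟩
    have h := hQ.2 (Set.mem_univ (y, t)) (Set.mem_univ (y, r)) ha hb hab
    simpa [← add_smul, hab] using h
  obtain ⟨s, hs⟩ := hQy.exists_subgradient_real (g y)
  -- Unit steps up and down bound the subgradient uniformly over the ball.
  have hs1 : s ≤ K₁ := by
    have h1 := hs (g y + 1)
    have h2 := le_trans (le_abs_self _) (hK₁ y hy')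
    linarith
  have hs2 : -s ≤ K₂ := by
    have h1 := hs (g y - 1)
    have h2 := le_trans (le_abs_self _) (hK₂ y hy')
    linarith
  have hmin : ∀ A, |s - A| ≤ c → partialMin P T A y = P (y, g y) - A * g y := by
    intro A hA
    refine (isLeast_partialMin hPc hT A y).unique ⟨⟨g y, abs_le.1 hgT, rfl⟩, ?_⟩
    rintro _ ⟨t, ht, rfl⟩
    have h1 := hcgap y t hyR (abs_le.2 ht)
    have h2 := hs t
    have h3 : -(c * |t - g y|) ≤ (s - A) * (t - g y) := by
      have : |(s - A) * (t - g y)| ≤ c * |t - g y| := by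
        rw [abs_mul]
        gcongr
      linarith [neg_abs_le ((s - A) * (t - g y))]
    simp only [hPQ y]
    linarith
  have hfl1 : (⌊s / c⌋ : ℝ) * c ≤ s := (le_div_iff₀ hc).1 (Int.floor_le _)
  have hfl2 : s < ((⌊s / c⌋ : ℝ) + 1) * c := (div_lt_iff₀ hc).1 (Int.lt_floor_add_one _)
  have hNc : max K₁ K₂ + c ≤ N * c := by
    have h := mul_le_mul_of_nonneg_right hN hc.le
    rwa [add_mul, div_mul_cancel₀ _ hc.ne', one_mul] at h
  refine ⟨⌊s / c⌋, Finset.mem_Icc.2 ⟨?_, ?_⟩, ?_⟩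
  · rw [Int.le_floor, le_div_iff₀ hc]
    push_cast
    linarith [le_max_right K₁ K₂]
  · have h : (⌊s / c⌋ : ℝ) ≤ N := by
      refine le_of_mul_le_mul_right ?_ hc
      linarith [le_max_left K₁ K₂]
    exact_mod_cast h
  -- Both `⌊s / c⌋ * c` and the next multiple of `c` lie within `c` of `s`.
  · rw [hmin _ (abs_le.2 ⟨by linarith, by linarith⟩), hmin _ (abs_le.2 ⟨by linarith, by linarith⟩)]
    field_simp
    ring

end PartialMin

/-! ### Distance to the graph -/

/-- Near a bounded piece of the graph of a locally Lipschitz function, the vertical distance to the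
graph is controlled by the distance to the graph. -/
theorem LocallyLipschitz.exists_vertical_gap {E : Type*} [NormedAddCommGroup E] [ProperSpace E]
    {g : E → ℝ} (hg : LocallyLipschitz g) (R T : ℝ) :
    ∃ c > 0, ∀ y t, ‖y‖ ≤ R → |t| ≤ T → ∀ y',
      c * |t - g y| ≤ max ‖y - y'‖ |t - g y'| := by
  have hK : IsCompact (Metric.closedBall (0 : E) (R + 1)) := isCompact_closedBall 0 _
  obtain ⟨T₀, hT₀⟩ := hK.exists_bound_of_continuousOn hg.continuous.continuousOn
  obtain ⟨L, hL⟩ := hg.locallyLipschitzOn.exists_lipschitzOnWith_of_compact hK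
  set B := max (T + T₀) 0
  have hB : 0 ≤ B := le_max_right _ _
  have hL0 : (0 : ℝ) ≤ L := L.2
  refine ⟨min (1 / (B + 1)) (1 / (1 + L)), by positivity, fun y t hy ht y' => ?_⟩
  have hyK : y ∈ Metric.closedBall (0 : E) (R + 1) := by simp; linarith
  have habs : |t - g y| ≤ B := by
    have h1 : |g y| ≤ T₀ := hT₀ y hyK
    exact (abs_sub _ _).trans ((add_le_add ht h1).trans (le_max_left _ _))
  -- Far points `y'` escape the Lipschitz bound, but there the maximum is at least 1, and `1 / (B +
  -- 1)` scales the left side below 1.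
  rcases le_total 1 ‖y - y'‖ with h | h
  · refine le_trans ?_ (h.trans (le_max_left _ _))
    calc min (1 / (B + 1)) (1 / (1 + L)) * |t - g y| ≤ 1 / (B + 1) * B := by
          gcongr
          exact min_le_left _ _
      _ ≤ 1 := by
          rw [one_div_mul_eq_div, div_le_one (by positivity)]
          linarith
  · have hyK' : y' ∈ Metric.closedBall (0 : E) (R + 1) := by
      have := norm_sub_norm_le y' y
      rw [norm_sub_rev] at this
      simp
      linarith
    have hlip : |g y' - g y| ≤ L * ‖y - y'‖ := by
      have := hL.dist_le_mul y' hyK' y hyK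
      rwa [Real.dist_eq, dist_eq_norm, norm_sub_rev] at this
    have htri : |t - g y| ≤ |t - g y'| + |g y' - g y| := abs_sub_le _ _ _
    set m := max ‖y - y'‖ |t - g y'|
    have hm1 : ‖y - y'‖ ≤ m := le_max_left _ _
    have hm2 : |t - g y'| ≤ m := le_max_right _ _
    calc min (1 / (B + 1)) (1 / (1 + L)) * |t - g y| ≤ 1 / (1 + L) * ((1 + L) * m) := by
          gcongr
          · exact min_le_right _ _
          · nlinarith
      _ = m := by field_simp

/-- The linear map `(y, t) ↦ (y₁, …, yₙ, t)` from `ℝⁿ × ℝ` to `ℝⁿ⁺¹`. -/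
noncomputable def euclideanSnoc (n : ℕ) :
    EuclideanSpace ℝ (Fin n) × ℝ →ₗ[ℝ] EuclideanSpace ℝ (Fin (n + 1)) where
  toFun z := WithLp.toLp 2 (Fin.snoc (α := fun _ => ℝ) (fun i => z.1 i) z.2)
  map_add' z w := by
    ext i
    refine Fin.lastCases ?_ (fun i => ?_) i <;> simp
  map_smul' a z := by
    ext i
    refine Fin.lastCases ?_ (fun i => ?_) i <;> simp

theorem max_norm_init_last_le {n : ℕ} (x : EuclideanSpace ℝ (Fin (n + 1))) :
    max ‖(WithLp.toLp 2 fun i : Fin n => x i.castSucc : EuclideanSpace ℝ (Fin n))‖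
      |x (Fin.last n)| ≤ ‖x‖ := by
  refine max_le ?_ (PiLp.norm_apply_le x (Fin.last n))
  rw [EuclideanSpace.norm_eq, EuclideanSpace.norm_eq, Fin.sum_univ_castSucc]
  refine Real.sqrt_le_sqrt ?_
  simp only [le_add_iff_nonneg_right]
  positivity

theorem euclideanSnoc_mem_euclideanGraph {n : ℕ} (g : EuclideanSpace ℝ (Fin n) → ℝ)
    (y : EuclideanSpace ℝ (Fin n)) : euclideanSnoc n (y, g y) ∈ euclideanGraph g := by
  simp [euclideanSnoc, euclideanGraph]

theorem proposition4p3 (n : ℕ) (hn : 1 ≤ n) (g : EuclideanSpace ℝ (Fin n) → ℝ)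
    (hg : LocallyLipschitz g) (hA : euclideanGraph g ∈ DCDistSets (n + 1)) :
    IsDC g := by
  have hne : (euclideanGraph g).Nonempty := ⟨_, euclideanSnoc_mem_euclideanGraph g 0⟩
  rcases hA with hA | ⟨-, -, p, q, hp, hq, hpq⟩
  · exact absurd hA hne.ne_empty
  replace hpq : ∀ x, Metric.infDist x (euclideanGraph g) = p x - q x := hpq
  refine isDC_of_convex_gap hg.continuous (hp.comp_linearMap (euclideanSnoc n))
    (hq.comp_linearMap (euclideanSnoc n)) (fun y => ?_) fun R T => ?_
  · have h := hpq (euclideanSnoc n (y, g y))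
    rw [Metric.infDist_zero_of_mem (euclideanSnoc_mem_euclideanGraph g y)] at h
    exact (sub_eq_zero.1 h.symm)
  · obtain ⟨c, hc, hgap⟩ := hg.exists_vertical_gap R T
    refine ⟨c, hc, fun y t hy ht => ?_⟩
    have h : c * |t - g y| ≤ Metric.infDist (euclideanSnoc n (y, t)) (euclideanGraph g) := by
      refine (Metric.le_infDist hne).2 fun z hz => ?_
      have hz' : z (Fin.last n) = g (WithLp.toLp 2 fun i : Fin n => z i.castSucc) := hz
      have h1 := hgap y t hy ht (WithLp.toLp 2 fun i : Fin n => z i.castSucc)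
      have h2 := max_norm_init_last_le (euclideanSnoc n (y, t) - z)
      rw [dist_eq_norm]
      refine (h1.trans (le_of_eq ?_)).trans h2
      rw [← hz']
      congr 2
      · ext i
        simp [euclideanSnoc]
      · simp [euclideanSnoc]
    have h3 := hpq (euclideanSnoc n (y, t))
    simp only [Function.comp_apply]
    linarith
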